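/- Let $\Delta$ be an irreducible reduced crystallographic root system of simply-laced type, spanning a finite-dimensional real vector space $\mathfrak h^*_{\mathbb R}$, with coroots $\alpha^\vee$, simple roots $\{\alpha_i\}_{i\in I}$, positive roots $\Delta^+$, fundamental weights $\varpi_i$, and Weyl group $W$ generated by the simple reflections $s_i=s_{\alpha_i}$, with length function $\ell$ and longest element $w_\circ$. For $\alpha\in\Delta$ and $k\in\mathbb Z$ put $H_{\alpha,k}=\{\nu\in\mathfrak h^*_{\mathbb R}\mid\langle\nu,\alpha^\vee\rangle=k\}$. The alcoves are the connected components of the complement of the union of all $H_{\alpha,k}$; the fundamental alcove is $A_\circ=\{\nu\mid 0<\langle\nu,\alpha^\vee\rangle<1\text{ for all }\alpha\in\Delta^+\}$. Two alcoves are adjacent if they are distinct and have a common wall; one writes $A\xrightarrow{\alpha}B$ if $A,B$ are adjacent, their common wall is orthogonal to $\alpha\in\Delta$ (that is, lies in some $H_{\alpha,k}$), and $\alpha$ points in the direction from $A$ to $B$. An alcove path of length $m$ is a sequence of alcoves $(A_0,\dots,A_m)$ with $A_{t-1},A_t$ adjacent for all $1\le t\le m$; it is reduced if it has minimal length among all alcove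 paths from $A_0$ to $A_m$. Let $\lambda$ be a (not necessarily dominant) minuscule weight, that is, $\langle\lambda,\alpha^\vee\rangle\in\{-1,0,1\}$ for all $\alpha\in\Delta$, let $\varpi_k$ be the fundamental weight contained in $W\lambda$ (so $\lambda\neq 0$), let $x\in W$ be the element of minimal length with $\lambda=x\varpi_k$, and let $y\in W$ be such that $yx$ is the element of minimal length in $\{w\in W\mid w\varpi_k=w_\circ\varpi_k\}$. Let $x=s_{j_a}\cdots s_{j_1}$ and $y=s_{i_1}\cdots s_{i_b}$ be reduced expressions, and set $$\beta_c=s_{j_a}\cdots s_{j_{c+1}}\alpha_{j_c}\quad(1\le c\le a),\qquad \zeta_d=s_{i_b}\cdots s_{i_{d+1}}\alpha_{i_d}\quad(1\le d\le b).$$ **Lemma 4.1.** Write $(\gamma_1,\dots,\gamma_{a+b})=(-\beta_a,\dots,-\beta_1,\zeta_1,\dots,\zeta_b)$. There is exactly one alcove path $\Gamma=(A_0,\dots,A_{a+b})$ from $A_0=A_\circ$ to $A_{a+b}=A_\lambda:=A_\circ+\lambda$ with $A_{t-1}\xrightarrow{\gamma_t}A_t$ for all $1\le t\le a+b$, and this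 path is reduced. Moreover, for $1\le c\le a$ the affine hyperplane containing the common wall of the $(c-1)$-th and the $c$-th alcove of $\Gamma$ is $H_{-\beta_{a-c+1},0}$, and for $1\le d\le b$ the affine hyperplane containing the common wall of the $(a+d-1)$-th and the $(a+d)$-th alcove is $H_{\zeta_d,1}$. -/

import Mathlib

open Set

noncomputable section

namespace AlcoveModel

variable {ι M N : Type*} [AddCommGroup M] [Module ℝ M] [AddCommGroup N] [Module ℝ N]

section Weyl

variable {P : RootPairing ι ℝ M N}

/-- The product `s_{i₁} s_{i₂} ⋯ s_{iₙ}` of simple reflections, as an element of the Weyl group. -/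
def wordProd (b : P.Base) (l : List b.support) : P.weylGroup :=
  (l.map fun i => RootPairing.weylGroup.ofIdx P (i : ι)).prod

/-- The length of a Weyl group element with respect to the simple reflections. -/
def length (b : P.Base) (w : P.weylGroup) : ℕ :=
  sInf {n | ∃ l : List b.support, l.length = n ∧ wordProd b l = w}

/-- The word `l` is a reduced expression for `w`. -/
def IsReducedExpression (b : P.Base) (l : List b.support) (w : P.weylGroup) : Prop :=
  wordProd b l = w ∧ l.length = length b w

/-- `w` is a longest element of the Weyl group. -/
def IsLongest (b : P.Base) (w : P.weylGroup) : Prop :=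
  ∀ v : P.weylGroup, length b v ≤ length b w

/-- `w` is an element of minimal length of the subset `S` of the Weyl group. -/
def IsMinLength (b : P.Base) (S : Set P.weylGroup) (w : P.weylGroup) : Prop :=
  w ∈ S ∧ ∀ v ∈ S, length b w ≤ length b v

/-- `ϖ` is the fundamental weight attached to the simple root `k`: `⟨ϖ, α_j^∨⟩ = δ_{jk}`. -/
def IsFundamentalWeight (b : P.Base) (k : b.support) (ϖ : M) : Prop :=
  P.coroot' (k : ι) ϖ = 1 ∧ ∀ j : b.support, j ≠ k → P.coroot' (j : ι) ϖ = 0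

/-- For simple roots `j₁, …, jₙ` (stored as `j 0, …, j (n - 1)`), the index of the root
`s_{jₙ} s_{jₙ₋₁} ⋯ s_{j_{c+1}} α_{j_c}`. -/
def wordRoot (b : P.Base) {n : ℕ} (j : Fin n → b.support) (c : Fin n) : ι :=
  P.weylGroupToPerm (wordProd b ((List.ofFn j).drop (c + 1)).reverse) (j c)

end Weyl

variable (P : RootPairing ι ℝ M N)

/-- The index of the root `-α`, where `α` is the root with index `i`. -/
def negIdx (i : ι) : ι := P.reflectionPerm i i

/-- `λ` is minuscule: `⟨λ, α^∨⟩ ∈ {-1, 0, 1}` for all roots `α`. -/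
def IsMinuscule (lam : M) : Prop :=
  ∀ i, P.coroot' i lam = -1 ∨ P.coroot' i lam = 0 ∨ P.coroot' i lam = 1

/-- The affine hyperplane `H_{α,k} = {ν | ⟨ν, α^∨⟩ = k}`. -/
def hyperplane (i : ι) (k : ℤ) : Set M := {ν | P.coroot' i ν = k}

/-- The complement of the union of all the hyperplanes `H_{α,k}`. -/
def regularSet : Set M := (⋃ (i : ι) (k : ℤ), hyperplane P i k)ᶜ

/-- The fundamental alcove. -/
def fundamentalAlcove {P : RootPairing ι ℝ M N} (b : P.Base) : Set M :=
  {ν | ∀ i, b.IsPos i → 0 < P.coroot' i ν ∧ P.coroot' i ν < 1}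

variable [TopologicalSpace M]

/-- An alcove is one of the regions into which the hyperplanes divide the space, that is, a
connected component of the complement of their union. -/
def IsAlcove (A : Set M) : Prop :=
  ∃ ν ∈ regularSet P, A = connectedComponentIn (regularSet P) ν

/-- The alcoves `A` and `B` have a common wall, which lies in `H_{α,k}`: the intersection of their
closures is a codimension one face, whose affine span is `H_{α,k}`. -/
def HasCommonWall (A B : Set M) (i : ι) (k : ℤ) : Prop :=
  (affineSpan ℝ (closure A ∩ closure B) : Set M) = hyperplane P i k

/-- Two alcoves are adjacent if they are distinct and have a common wall. -/
def Adjacent (A B : Set M) : Prop :=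
  A ≠ B ∧ ∃ i k, HasCommonWall P A B i k

/-- `A --α--> B`: the alcoves `A` and `B` are adjacent, their common wall is orthogonal to `α`
(it lies in some `H_{α,k}`), and `α` points in the direction from `A` to `B`. -/
def Step (A B : Set M) (i : ι) : Prop :=
  A ≠ B ∧ ∃ k, HasCommonWall P A B i k ∧
    (∀ ν ∈ A, P.coroot' i ν < k) ∧ (∀ ν ∈ B, (k : ℝ) < P.coroot' i ν)

/-- Alcove paths `(A₀, A₁, …, Aₘ)`. -/
def IsAlcovePath {m : ℕ} (A : Fin (m + 1) → Set M) : Prop :=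
  (∀ t, IsAlcove P (A t)) ∧ ∀ t : Fin m, Adjacent P (A t.castSucc) (A t.succ)

/-- An alcove path is reduced if it has minimal length among all alcove paths with the same two
ends. -/
def IsReducedAlcovePath {m : ℕ} (A : Fin (m + 1) → Set M) : Prop :=
  IsAlcovePath P A ∧ ∀ (n : ℕ) (B : Fin (n + 1) → Set M), IsAlcovePath P B →
    B 0 = A 0 → B (Fin.last n) = A (Fin.last m) → m ≤ n

/-- `A` is the alcove path from the fundamental alcove `A_∘` to `A_λ = A_∘ + λ` that is written
`(γ₁, …, γₘ)`. -/
def IsAlcovePathOfRoots {P : RootPairing ι ℝ M N} (b : P.Base) (lam : M) {m : ℕ}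
    (γ : Fin m → ι) (A : Fin (m + 1) → Set M) : Prop :=
  IsAlcovePath P A ∧ A 0 = fundamentalAlcove b ∧
    A (Fin.last m) = (fun ν => ν + lam) '' fundamentalAlcove b ∧
    ∀ t : Fin m, Step P (A t.castSucc) (A t.succ) (γ t)

end AlcoveModel

end

/-!
Record an alcove by its integer coordinates, the values `⌊⟨ν, α^∨⟩⌋` at all roots `α` for any point
`ν` of the alcove. The alcoves are exactly the nonempty cells with prescribed coordinates
(`isAlcove_iff`), and a step `A --α--> B` raises the coordinate at `α` by one, lowers the one at
`-α` by one and changes no other (`Step.unitStep`); conversely two alcoves whose coordinates differ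
in this way share a wall in `H_{α,k}`, where `k` is the coordinate of `B` at `α`
(`UnitStep.hasCommonWall`). Hence an alcove path is determined by its start and its roots
(`alcovePath_unique`).

The path itself consists of the alcoves `s_{j_a} ⋯ s_{j_{t+1}} A_∘`, which lead from `A_∘` to
`x A_∘` through the walls `H_{-β,0}`, followed by the translates
`s_{i_b} ⋯ s_{i_{t+1}} A_∘ + λ`, which lead from `y⁻¹ A_∘ + λ` to `A_∘ + λ`. Multiplication by a
simple reflection on the right is a unit step (`unitStep_weylCoord_mul`), and the two halves fit
together because `x A_∘ = y⁻¹ A_∘ + λ` (`weylCoord_eq_add`): at a root `γ` with `⟨λ, γ^∨⟩ ≠ 0` the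
signs of `x⁻¹ γ` and of `y γ` are known from the dominance of `ϖ` and the antidominance of `w₀ ϖ`,
and at a root with `⟨λ, γ^∨⟩ = 0` they agree since `y x` has minimal length.

Minimality of `x` and of `y x` gives `⟨λ, β^∨⟩ = -1` and `⟨λ, ζ^∨⟩ = 1`
(`coroot'_wordRoot_eq_neg_one`, `coroot'_wordRoot_eq_one`), so every root of the path pairs to `1`
with `λ`. This puts the walls of the second half into `H_{ζ,1}`, and it makes the path reduced: the
sum of the coordinates over the roots `γ` with `⟨λ, γ^∨⟩ = 1` grows by one along each of its steps,
while no step of any alcove path changes it by more than one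
(`isReducedAlcovePath_of_coroot'_eq_one`). The facts on lengths that this needs follow from the
strong exchange condition (`exists_shorter_word`).
-/

namespace AlcoveModel

section WeylGroup

variable {ι M N : Type*} [AddCommGroup M] [Module ℝ M] [AddCommGroup N] [Module ℝ N]
  {P : RootPairing ι ℝ M N}

/-! ### Negation of roots and the Weyl group action -/

lemma coroot'_negIdx (i : ι) (ν : M) : P.coroot' (negIdx P i) ν = -P.coroot' i ν := by
  simp [negIdx]

lemma negIdx_negIdx (i : ι) : negIdx P (negIdx P i) = i :=
  letI := P.indexNeg
  neg_neg i

lemma isPos_negIdx (b : P.Base) (i : ι) : b.IsPos (negIdx P i) ↔ ¬ b.IsPos i :=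
  RootPairing.Base.IsPos.neg_iff_not b i

lemma weylGroupToPerm_ofIdx (i k : ι) :
    P.weylGroupToPerm (RootPairing.weylGroup.ofIdx P i) k = P.reflectionPerm i k := rfl

lemma ofIdx_smul_apply (i : ι) (ν : M) :
    RootPairing.weylGroup.ofIdx P i • ν = ν - P.coroot' i ν • P.root i :=
  P.reflection_apply i ν

lemma ofIdx_mul_self (i : ι) :
    RootPairing.weylGroup.ofIdx P i * RootPairing.weylGroup.ofIdx P i = 1 := by
  apply Subtype.ext
  have h := RootPairing.Equiv.reflection_inv P i
  rw [inv_eq_iff_mul_eq_one] at h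
  exact h

lemma ofIdx_inv (i : ι) :
    (RootPairing.weylGroup.ofIdx P i)⁻¹ = RootPairing.weylGroup.ofIdx P i :=
  inv_eq_of_mul_eq_one_left (ofIdx_mul_self i)

lemma coroot'_weylGroupToPerm_smul (w : P.weylGroup) (i : ι) (ν : M) :
    P.coroot' (P.weylGroupToPerm w i) (w • ν) = P.coroot' i ν := by
  obtain ⟨g, hg⟩ := w
  induction hg using RootPairing.weylGroup.induction generalizing i ν with
  | mem k =>
    change P.coroot' (P.reflectionPerm k i) (P.reflection k ν) = _
    rw [← P.coroot'_reflection]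
    simp
  | one => rfl
  | mul x y hx hy ihx ihy =>
    exact (ihx (P.weylGroupToPerm ⟨y, hy⟩ i) ((⟨y, hy⟩ : P.weylGroup) • ν)).trans (ihy i ν)

lemma coroot'_smul (w : P.weylGroup) (i : ι) (ν : M) :
    P.coroot' i (w • ν) = P.coroot' (P.weylGroupToPerm w⁻¹ i) ν := by
  have h := coroot'_weylGroupToPerm_smul w (P.weylGroupToPerm w⁻¹ i) ν
  rwa [← Equiv.Perm.mul_apply, ← map_mul, mul_inv_cancel, map_one] at h

lemma weylGroupToPerm_negIdx (w : P.weylGroup) (i : ι) :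
    P.weylGroupToPerm w (negIdx P i) = negIdx P (P.weylGroupToPerm w i) := by
  apply P.root.injective
  have h (k : ι) : P.root (negIdx P k) = -P.root k := by simp [negIdx]
  rw [← P.weylGroup_apply_root, h, h, smul_neg, P.weylGroup_apply_root]

lemma weylGroup_ext {v w : P.weylGroup} (h : ∀ ν : M, v • ν = w • ν) : v = w := by
  apply Subtype.ext
  apply RootPairing.Equiv.weightHom_injective P
  ext ν
  exact h ν

lemma ofIdx_weylGroupToPerm (w : P.weylGroup) (i : ι) :
    RootPairing.weylGroup.ofIdx P (P.weylGroupToPerm w i) =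
      w * RootPairing.weylGroup.ofIdx P i * w⁻¹ := by
  apply weylGroup_ext
  intro ν
  rw [mul_smul, mul_smul, ofIdx_smul_apply, ofIdx_smul_apply, smul_sub, smul_inv_smul,
    ← coroot'_weylGroupToPerm_smul w i (w⁻¹ • ν), smul_inv_smul]
  congr 1
  change _ = (w : P.Aut) • (_ • P.root i)
  rw [smul_comm, ← P.weylGroup_apply_root]
  rfl

lemma weylGroupToPerm_ofIdx_self (i : ι) :
    P.weylGroupToPerm (RootPairing.weylGroup.ofIdx P i) i = negIdx P i := rfl

lemma weylGroupToPerm_inv_apply_eq (w : P.weylGroup) (i k : ι) :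
    P.weylGroupToPerm w⁻¹ i = k ↔ i = P.weylGroupToPerm w k := by
  rw [map_inv, Equiv.Perm.inv_eq_iff_eq]

/-! ### Positivity of roots and words in the simple reflections -/

lemma wordProd_nil (b : P.Base) : wordProd b [] = 1 := rfl

lemma wordProd_cons (b : P.Base) (j : b.support) (l : List b.support) :
    wordProd b (j :: l) = RootPairing.weylGroup.ofIdx P (j : ι) * wordProd b l := by
  simp [wordProd]

lemma wordProd_append (b : P.Base) (l l' : List b.support) :
    wordProd b (l ++ l') = wordProd b l * wordProd b l' := by
  simp [wordProd]

lemma wordProd_reverse (b : P.Base) (l : List b.support) :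
    wordProd b l.reverse = (wordProd b l)⁻¹ := by
  induction l with
  | nil => simp [wordProd]
  | cons j l ih =>
    rw [List.reverse_cons, wordProd_append, ih, wordProd_cons, wordProd_cons, mul_inv_rev,
      ofIdx_inv, wordProd_nil, mul_one]

lemma length_wordProd_le (b : P.Base) (l : List b.support) :
    length b (wordProd b l) ≤ l.length :=
  Nat.sInf_le ⟨l, rfl, rfl⟩

variable [Finite ι] [P.IsCrystallographic] [P.IsReduced]

/-- A simple reflection permutes the positive roots other than its own simple root. -/
lemma isPos_reflectionPerm_iff (b : P.Base) {i j : ι} (hj : j ∈ b.support) (hij : i ≠ j)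
    (hij' : i ≠ negIdx P j) : b.IsPos (P.reflectionPerm j i) ↔ b.IsPos i := by
  refine ⟨fun h => ?_, fun h => h.reflectionPerm hj hij⟩
  have h' := h.reflectionPerm hj fun h1 => hij' <|
    (P.reflectionPerm_self j i).symm.trans (congrArg _ h1)
  rwa [P.reflectionPerm_self] at h'

/-- The Weyl group is generated by the simple reflections. -/
lemma exists_wordProd_eq (b : P.Base) (w : P.weylGroup) : ∃ l, wordProd b l = w := by
  obtain ⟨g, hg⟩ := w
  induction hg using RootPairing.weylGroup.induction with
  | mem i =>
    change ∃ l, wordProd b l = RootPairing.weylGroup.ofIdx P i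
    refine b.induction_reflect i (p := fun i => ∃ l, wordProd b l =
      RootPairing.weylGroup.ofIdx P i) ?_ ?_ ?_
    · rintro i ⟨l, hl⟩
      refine ⟨l, ?_⟩
      rw [hl, ← weylGroupToPerm_ofIdx, ofIdx_weylGroupToPerm]
      simp
    · intro i hi
      exact ⟨[⟨i, hi⟩], by simp [wordProd]⟩
    · rintro i j ⟨l, hl⟩ hj
      refine ⟨⟨j, hj⟩ :: l ++ [⟨j, hj⟩], ?_⟩
      rw [← weylGroupToPerm_ofIdx, ofIdx_weylGroupToPerm, wordProd_append, wordProd_cons, hl,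
        ofIdx_inv]
      simp [wordProd]
  | one => exact ⟨[], rfl⟩
  | mul x y hx hy ihx ihy =>
    obtain ⟨l, hl⟩ := ihx
    obtain ⟨l', hl'⟩ := ihy
    exact ⟨l ++ l', by rw [wordProd_append, hl, hl']; rfl⟩

lemma exists_isReducedExpression (b : P.Base) (w : P.weylGroup) :
    ∃ l, IsReducedExpression b l w := by
  obtain ⟨l₀, h₀⟩ := exists_wordProd_eq b w
  obtain ⟨l, hl, hw⟩ := Nat.sInf_mem
    (s := {n | ∃ l : List b.support, l.length = n ∧ wordProd b l = w}) ⟨_, l₀, rfl, h₀⟩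
  exact ⟨l, hw, hl⟩

/-- The strong exchange condition: if `w` makes a positive root `α` negative, then some letter can
be deleted from a word for `w` to give a word for `w s_α`. -/
lemma exists_shorter_word (b : P.Base) (l : List b.support) {i : ι} (hi : b.IsPos i)
    (hl : ¬ b.IsPos (P.weylGroupToPerm (wordProd b l) i)) :
    ∃ l' : List b.support, l'.length + 1 = l.length ∧
      wordProd b l' = wordProd b l * RootPairing.weylGroup.ofIdx P i := by
  induction l with
  | nil => exact absurd hi (by simpa [wordProd_nil] using hl)
  | cons j l ih =>
    by_cases h : b.IsPos (P.weylGroupToPerm (wordProd b l) i)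
    · -- the sign changes at the letter `j`, so `l` takes `α` to the simple root of `j`
      have hij : P.weylGroupToPerm (wordProd b l) i = j := by
        by_contra hne
        rw [wordProd_cons, map_mul, Equiv.Perm.mul_apply, weylGroupToPerm_ofIdx] at hl
        exact hl (h.reflectionPerm j.2 hne)
      refine ⟨l, by simp, ?_⟩
      rw [wordProd_cons, ← hij, ofIdx_weylGroupToPerm]
      simp [mul_assoc, ofIdx_mul_self]
    · obtain ⟨l', h1, h2⟩ := ih h
      exact ⟨j :: l', by simpa using h1, by rw [wordProd_cons, h2, wordProd_cons, mul_assoc]⟩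

lemma length_mul_ofIdx_lt (b : P.Base) (w : P.weylGroup) {i : ι} (hi : b.IsPos i)
    (hw : ¬ b.IsPos (P.weylGroupToPerm w i)) :
    length b (w * RootPairing.weylGroup.ofIdx P i) < length b w := by
  obtain ⟨l, rfl, hl⟩ := exists_isReducedExpression b w
  obtain ⟨l', h1, h2⟩ := exists_shorter_word b l hi hw
  have := length_wordProd_le b l'
  rw [h2] at this
  omega

lemma IsReducedExpression.isPos_left {b : P.Base} {w : P.weylGroup} {p q : List b.support}
    {j : b.support} (h : IsReducedExpression b (p ++ j :: q) w) :
    b.IsPos (P.weylGroupToPerm (wordProd b p) j) := by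
  by_contra hn
  obtain ⟨p', h1, h2⟩ := exists_shorter_word b p (b.isPos_of_mem_support j.2) hn
  have h3 := length_wordProd_le b (p' ++ q)
  rw [wordProd_append, h2, mul_assoc, ← wordProd_cons, ← wordProd_append, h.1, ← h.2] at h3
  simp only [List.length_append, List.length_cons] at h3
  omega

lemma IsReducedExpression.isPos_right {b : P.Base} {w : P.weylGroup} {p q : List b.support}
    {j : b.support} (h : IsReducedExpression b (p ++ j :: q) w) :
    b.IsPos (P.weylGroupToPerm (wordProd b q)⁻¹ j) := by
  rw [← wordProd_reverse]
  have h' : IsReducedExpression b (q.reverse ++ j :: p.reverse) w⁻¹ := by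
    have e : q.reverse ++ j :: p.reverse = (p ++ j :: q).reverse := by simp
    rw [e]
    refine ⟨by rw [wordProd_reverse, h.1], le_antisymm ?_ ?_⟩
    · obtain ⟨l, h1, h2⟩ := exists_isReducedExpression b w⁻¹
      have h3 := length_wordProd_le b l.reverse
      rw [wordProd_reverse, h1, inv_inv, ← h.2, List.length_reverse] at h3
      rw [List.length_reverse]
      omega
    · rw [← h.1, ← wordProd_reverse]
      exact length_wordProd_le b _
  exact h'.isPos_left

/-- The longest element makes every positive root negative. -/
lemma IsLongest.not_isPos {b : P.Base} {w : P.weylGroup} (hw : IsLongest b w) {i : ι}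
    (hi : b.IsPos i) : ¬ b.IsPos (P.weylGroupToPerm w i) := by
  intro h
  have hlt := length_mul_ofIdx_lt b (w * RootPairing.weylGroup.ofIdx P i) hi (by
    rwa [map_mul, Equiv.Perm.mul_apply, weylGroupToPerm_ofIdx_self, weylGroupToPerm_negIdx,
      isPos_negIdx, not_not])
  rw [mul_assoc, ofIdx_mul_self, mul_one] at hlt
  exact absurd (hw _) (not_le.2 hlt)

/-- An element of minimal length among those with a given value on `ϖ` keeps the sign of every
root orthogonal to `ϖ`. -/
lemma IsMinLength.isPos_iff {b : P.Base} {ϖ μ : M} {w : P.weylGroup}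
    (hw : IsMinLength b {v | v • ϖ = μ} w) {i : ι} (hi : P.coroot' i ϖ = 0) :
    b.IsPos (P.weylGroupToPerm w i) ↔ b.IsPos i := by
  have key {k : ι} (hk : P.coroot' k ϖ = 0) (hpos : b.IsPos k) :
      b.IsPos (P.weylGroupToPerm w k) := by
    by_contra hn
    refine absurd (hw.2 (w * RootPairing.weylGroup.ofIdx P k) ?_)
      (not_le.2 (length_mul_ofIdx_lt b w hpos hn))
    rw [mem_ofPred_eq, mul_smul, ofIdx_smul_apply, hk, zero_smul, sub_zero]
    exact hw.1
  refine ⟨fun h => ?_, key hi⟩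
  by_contra hn
  have := key (k := negIdx P i) (by rw [coroot'_negIdx, hi, neg_zero])
    ((isPos_negIdx b i).2 hn)
  rw [weylGroupToPerm_negIdx, isPos_negIdx] at this
  exact this h

/-- A root is positive exactly when its coroot is. -/
lemma isPos_flip_iff (b : P.Base) (i : ι) : b.flip.IsPos i ↔ b.IsPos i := by
  have hneg (k : ι) : b.flip.IsPos (P.reflectionPerm k k) ↔ ¬ b.flip.IsPos k :=
    RootPairing.Base.IsPos.neg_iff_not b.flip k
  have hneg' (k : ι) : b.IsPos (P.reflectionPerm k k) ↔ ¬ b.IsPos k := isPos_negIdx b k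
  have hsimple {k : ι} (hk : k ∈ b.support) : b.flip.IsPos k ↔ b.IsPos k :=
    iff_of_true (RootPairing.Base.isPos_of_mem_support (b := b.flip) hk)
      (RootPairing.Base.isPos_of_mem_support hk)
  refine b.induction_reflect i (fun i h => ?_) (fun i hi => hsimple hi) (fun i j h hj => ?_)
  · rw [hneg, hneg', h]
  · rcases eq_or_ne i j with rfl | hij
    · rw [hneg, hneg', h]
    rcases eq_or_ne i (negIdx P j) with rfl | hij'
    · rw [negIdx, P.reflectionPerm_self, hsimple hj]
    rw [isPos_reflectionPerm_iff b hj hij hij', ← h]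
    exact isPos_reflectionPerm_iff b.flip (P := P.flip) hj hij hij'

lemma coroot_eq_sum_of_isPos (b : P.Base) {i : ι} (hi : b.IsPos i) :
    ∃ f : ι → ℕ, P.coroot i = ∑ j ∈ b.support, f j • P.coroot j := by
  obtain ⟨f, -, hf | hf⟩ := b.flip.exists_root_eq_sum_nat_or_neg i
  · exact ⟨f, hf⟩
  · exfalso
    have h1 : P.flip.root i = ∑ j ∈ b.flip.support, (fun j => -(f j : ℤ)) j • P.flip.root j := by
      rw [hf]; simp
    have h2 := RootPairing.Base.height_eq_sum h1
    have h3 := (isPos_flip_iff b i).2 hi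
    rw [RootPairing.Base.isPos_iff, h2] at h3
    refine absurd h3 (not_lt.2 (Finset.sum_nonpos fun j _ => ?_))
    simp

lemma coroot'_nonneg_of_isPos (b : P.Base) {ϖ : M} (hϖ : ∀ j ∈ b.support, 0 ≤ P.coroot' j ϖ)
    {i : ι} (hi : b.IsPos i) : 0 ≤ P.coroot' i ϖ := by
  obtain ⟨f, hf⟩ := coroot_eq_sum_of_isPos b hi
  rw [RootPairing.coroot', hf, map_sum, LinearMap.sum_apply]
  refine Finset.sum_nonneg fun j hj => ?_
  rw [map_nsmul, LinearMap.smul_apply]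
  exact nsmul_nonneg (hϖ j hj) _

lemma IsFundamentalWeight.coroot'_nonneg {b : P.Base} {k : b.support} {ϖ : M}
    (h : IsFundamentalWeight b k ϖ) {i : ι} (hi : b.IsPos i) : 0 ≤ P.coroot' i ϖ := by
  refine coroot'_nonneg_of_isPos b (fun j hj => ?_) hi
  by_cases hjk : (⟨j, hj⟩ : b.support) = k
  · subst hjk
    exact h.1.symm ▸ zero_le_one
  · exact (h.2 ⟨j, hj⟩ hjk).ge

lemma IsLongest.coroot'_smul_nonneg {b : P.Base} {w : P.weylGroup} (hw : IsLongest b w) {ϖ : M}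
    (hϖ : ∀ i, b.IsPos i → 0 ≤ P.coroot' i ϖ) {i : ι} (hi : ¬ b.IsPos i) :
    0 ≤ P.coroot' i (w • ϖ) := by
  rw [coroot'_smul]
  apply hϖ
  by_contra hn
  have h := hw.not_isPos ((isPos_negIdx b _).2 hn)
  rw [weylGroupToPerm_negIdx, isPos_negIdx, not_not, ← Equiv.Perm.mul_apply, ← map_mul] at h
  exact hi (by simpa using h)

end WeylGroup

section Alcoves

variable {ι M N : Type*} [AddCommGroup M] [Module ℝ M] [AddCommGroup N] [Module ℝ N]
  {P : RootPairing ι ℝ M N}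

/-! ### Alcoves as cells -/

variable (P) in
/-- The set of all points `ν` with `n i < ⟨ν, α_i^∨⟩ < n i + 1` for every root `α_i`. The alcoves
are the nonempty sets of this form. -/
def cell (n : ι → ℤ) : Set M := {ν | ∀ i, (n i : ℝ) < P.coroot' i ν ∧ P.coroot' i ν < n i + 1}

lemma floor_of_mem_cell {n : ι → ℤ} {ν : M} (h : ν ∈ cell P n) (i : ι) :
    ⌊P.coroot' i ν⌋ = n i :=
  Int.floor_eq_iff.2 ⟨(h i).1.le, (h i).2⟩

lemma eq_of_cell_eq {n n' : ι → ℤ} (hn : (cell P n).Nonempty) (h : cell P n = cell P n') :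
    n = n' := by
  obtain ⟨ν, hν⟩ := hn
  funext i
  exact (floor_of_mem_cell hν i).symm.trans (floor_of_mem_cell (h ▸ hν : ν ∈ cell P n') i)

lemma cell_negIdx {n : ι → ℤ} (hn : (cell P n).Nonempty) (i : ι) :
    n (negIdx P i) = -n i - 1 := by
  obtain ⟨ν, hν⟩ := hn
  have h1 := hν i
  have h2 := hν (negIdx P i)
  rw [coroot'_negIdx] at h2
  have h3 : (n (negIdx P i) : ℝ) < (-n i : ℤ) := by push_cast; linarith
  have h4 : ((-n i - 2 : ℤ) : ℝ) < n (negIdx P i) := by push_cast; linarith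
  rw [Int.cast_lt] at h3 h4
  omega

lemma mem_regularSet {ν : M} : ν ∈ regularSet P ↔ ∀ i (k : ℤ), P.coroot' i ν ≠ k := by
  simp [regularSet, hyperplane]

lemma cell_subset_regularSet (n : ι → ℤ) : cell P n ⊆ regularSet P := by
  intro ν hν
  rw [mem_regularSet]
  intro i k hk
  have h := hν i
  rw [hk] at h
  have h1 : n i < k := by exact_mod_cast h.1
  have h2 : k < n i + 1 := by exact_mod_cast h.2
  omega

lemma mem_cell_floor {ν : M} (hν : ν ∈ regularSet P) :
    ν ∈ cell P (fun i => ⌊P.coroot' i ν⌋) := fun i =>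
  ⟨lt_of_le_of_ne (Int.floor_le _) (mem_regularSet.1 hν i _).symm, Int.lt_floor_add_one _⟩

lemma convex_cell (n : ι → ℤ) : Convex ℝ (cell P n) := by
  have : cell P n = ⋂ i, P.coroot' i ⁻¹' Ioo (n i : ℝ) (n i + 1) := by
    ext ν; simp [cell]
  rw [this]
  exact convex_iInter fun i => (convex_Ioo _ _).linear_preimage (P.coroot' i)

/-- A hyperplane `H_{α,k}` that lies in `H_{γ,m}` forces `γ = ±α`. -/
lemma eq_or_eq_negIdx_of_hyperplane_subset [Finite ι] [P.IsReduced] {i k : ι} {p q : ℤ}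
    (h : hyperplane P i p ⊆ hyperplane P k q) : k = i ∨ k = negIdx P i := by
  -- the component of `γ` orthogonal to `α^∨` can be added to a point of `H_{α,k}`
  set δ : M := P.root k - (P.pairing k i / 2) • P.root i with hδ
  have h0 : ((p : ℝ) / 2) • P.root i ∈ hyperplane P i p := by
    simp [hyperplane]
  have h1 : ((p : ℝ) / 2) • P.root i + δ ∈ hyperplane P i p := by
    simp [hyperplane, hδ]
  have e : P.coroot' k δ = 0 := by
    have h0' : P.coroot' k _ = _ := h h0
    have h1' : P.coroot' k _ = _ := h h1
    rw [map_add, h0'] at h1'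
    linarith
  have hc : P.coxeterWeight k i = 4 := by
    rw [hδ, map_sub, map_smul, P.root_coroot'_eq_pairing, P.root_coroot'_eq_pairing,
      P.pairing_same, smul_eq_mul] at e
    rw [RootPairing.coxeterWeight]
    linarith
  rw [RootPairing.coxeterWeight_eq_four_iff_not_linearIndependent,
    RootPairing.IsReduced.linearIndependent_iff] at hc
  by_contra hn
  push Not at hn
  exact hc ⟨hn.1, fun h => hn.2 (by rwa [P.root_eq_neg_iff] at h)⟩

variable (P) in
/-- The coordinates `n'` arise from `n` by raising the one at `α` and lowering the one at `-α` by
one. This is what a step `A --α--> B` does to the coordinates of an alcove. -/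
def UnitStep (n n' : ι → ℤ) (i : ι) : Prop :=
  n' i = n i + 1 ∧ n' (negIdx P i) = n (negIdx P i) - 1 ∧
    ∀ j, j ≠ i → j ≠ negIdx P i → n' j = n j

lemma UnitStep.unique {n n' n'' : ι → ℤ} {i : ι} (h : UnitStep P n n' i)
    (h' : UnitStep P n n'' i) : n' = n'' := by
  funext j
  by_cases h1 : j = i
  · rw [h1, h.1, h'.1]
  by_cases h2 : j = negIdx P i
  · rw [h2, h.2.1, h'.2.1]
  rw [h.2.2 j h1 h2, h'.2.2 j h1 h2]

lemma affineSpan_subset_hyperplane {S : Set M} (hS : S.Nonempty) {i : ι} {k : ℤ}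
    (h : S ⊆ hyperplane P i k) : (affineSpan ℝ S : Set M) ⊆ hyperplane P i k := by
  obtain ⟨p, hp⟩ := hS
  have hp' : P.coroot' i p = k := h hp
  have hmem (q : M) : q ∈ AffineSubspace.mk' p (LinearMap.ker (P.coroot' i)) ↔
      q ∈ hyperplane P i k := by
    rw [AffineSubspace.mem_mk', vsub_eq_sub, LinearMap.mem_ker, map_sub, hp', sub_eq_zero]
    rfl
  exact fun q hq => (hmem q).1 (affineSpan_le.2 (fun q hq => (hmem q).2 (h hq)) hq)

lemma nonempty_of_hasCommonWall [TopologicalSpace M] {A B : Set M} {i : ι} {k : ℤ}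
    (h : HasCommonWall P A B i k) :
    (closure A ∩ closure B).Nonempty := by
  rw [← affineSpan_nonempty ℝ]
  rw [HasCommonWall] at h
  rw [h]
  exact ⟨((k : ℝ) / 2) • P.root i, by simp [hyperplane]⟩

variable [TopologicalSpace M] [IsTopologicalAddGroup M] [ContinuousSMul ℝ M] [T2Space M]
  [Finite ι] [P.IsRootSystem]

lemma continuous_coroot' (i : ι) : Continuous (P.coroot' i) := by
  have : FiniteDimensional ℝ M := by
    refine ⟨?_⟩
    rw [← RootPairing.IsRootSystem.span_root_eq_top (P := P)]
    exact Submodule.fg_span (Set.finite_range _)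
  exact LinearMap.continuous_of_finiteDimensional _

lemma connectedComponentIn_eq_cell {n : ι → ℤ} {ν : M} (hν : ν ∈ cell P n) :
    connectedComponentIn (regularSet P) ν = cell P n := by
  refine subset_antisymm ?_ ((convex_cell n).isPreconnected.subset_connectedComponentIn hν
    (cell_subset_regularSet n))
  have hνr := cell_subset_regularSet n hν
  intro μ hμ i
  have hC : OrdConnected (P.coroot' i '' connectedComponentIn (regularSet P) ν) :=
    (isPreconnected_connectedComponentIn.image _
      (continuous_coroot' i).continuousOn).ordConnected
  have hμ' := mem_image_of_mem (P.coroot' i) hμ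
  have hν' := mem_image_of_mem (P.coroot' i) (mem_connectedComponentIn hνr)
  have hno (k : ℤ) : (k : ℝ) ∉ P.coroot' i '' connectedComponentIn (regularSet P) ν := by
    rintro ⟨x, hx, hk⟩
    exact mem_regularSet.1 (connectedComponentIn_subset _ _ hx) i k hk
  constructor
  · by_contra! hle
    exact hno (n i) (hC.out hμ' hν' ⟨hle, (hν i).1.le⟩)
  · by_contra! hle
    refine hno (n i + 1) (hC.out hν' hμ' ⟨?_, ?_⟩)
    · push_cast; exact (hν i).2.le
    · push_cast; exact hle

lemma isAlcove_iff {A : Set M} : IsAlcove P A ↔ ∃ n, (cell P n).Nonempty ∧ A = cell P n := by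
  constructor
  · rintro ⟨ν, hν, rfl⟩
    exact ⟨_, ⟨ν, mem_cell_floor hν⟩, connectedComponentIn_eq_cell (mem_cell_floor hν)⟩
  · rintro ⟨n, ⟨ν, hν⟩, rfl⟩
    exact ⟨ν, cell_subset_regularSet n hν, (connectedComponentIn_eq_cell hν).symm⟩

lemma mem_closure_cell {n : ι → ℤ} (hn : (cell P n).Nonempty) {ν : M} :
    ν ∈ closure (cell P n) ↔ ∀ i, (n i : ℝ) ≤ P.coroot' i ν ∧ P.coroot' i ν ≤ n i + 1 := by
  constructor
  · intro h i
    have hcl : IsClosed {μ : M | (n i : ℝ) ≤ P.coroot' i μ ∧ P.coroot' i μ ≤ n i + 1} :=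
      (isClosed_le continuous_const (continuous_coroot' i)).inter
        (isClosed_le (continuous_coroot' i) continuous_const)
    have hsub : cell P n ⊆ {μ : M | (n i : ℝ) ≤ P.coroot' i μ ∧ P.coroot' i μ ≤ n i + 1} :=
      fun μ hμ => ⟨(hμ i).1.le, (hμ i).2.le⟩
    exact closure_minimal hsub hcl h
  · intro h
    -- the open segment from an inner point to `ν` consists of inner points
    obtain ⟨a, ha⟩ := hn
    have hseg : openSegment ℝ a ν ⊆ cell P n := by
      rintro _ ⟨s, t, hs, ht, hst, rfl⟩ i
      rw [map_add, map_smul, map_smul, smul_eq_mul, smul_eq_mul]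
      have h1 := mul_pos hs (sub_pos.2 (ha i).1)
      have h2 := mul_pos hs (sub_pos.2 (ha i).2)
      have h3 := mul_nonneg ht.le (sub_nonneg.2 (h i).1)
      have h4 := mul_nonneg ht.le (sub_nonneg.2 (h i).2)
      obtain rfl : t = 1 - s := by linarith
      constructor <;> nlinarith
    exact closure_mono hseg (segment_subset_closure_openSegment (𝕜 := ℝ) (right_mem_segment ℝ a ν))

/-! ### Walls -/

/-- Across a common wall in `H_{α,k}` the coordinate at a root changes by at most one, and not at
all at roots other than `±α`. -/
lemma HasCommonWall.cell_coord [P.IsReduced] {n n' : ι → ℤ} (hn : (cell P n).Nonempty)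
    (hn' : (cell P n').Nonempty) {i : ι} {k : ℤ}
    (h : HasCommonWall P (cell P n) (cell P n') i k) (j : ι) :
    (n' j ≤ n j + 1 ∧ n j ≤ n' j + 1) ∧ (j ≠ i → j ≠ negIdx P i → n' j = n j) := by
  have hS := nonempty_of_hasCommonWall h
  have hle : n' j ≤ n j + 1 ∧ n j ≤ n' j + 1 := by
    obtain ⟨ν, h1, h2⟩ := hS
    rw [mem_closure_cell hn] at h1
    rw [mem_closure_cell hn'] at h2
    exact ⟨by exact_mod_cast (h2 j).1.trans (h1 j).2, by exact_mod_cast (h1 j).1.trans (h2 j).2⟩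
  refine ⟨hle, fun hj hj' => ?_⟩
  by_contra hne
  -- otherwise the common face also lies in the hyperplane of `j` that separates the two cells
  have hsub : closure (cell P n) ∩ closure (cell P n') ⊆ hyperplane P j (max (n j) (n' j)) := by
    rintro ν ⟨h1, h2⟩
    rw [mem_closure_cell hn] at h1
    rw [mem_closure_cell hn'] at h2
    change P.coroot' j ν = ((max (n j) (n' j) : ℤ) : ℝ)
    rcases lt_or_gt_of_ne hne with hlt | hlt
    · have e : n j = n' j + 1 := by omega
      rw [max_eq_left hlt.le]
      refine le_antisymm ?_ (h1 j).1
      rw [e]; push_cast; exact (h2 j).2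
    · have e : n' j = n j + 1 := by omega
      rw [max_eq_right hlt.le]
      refine le_antisymm ?_ (h2 j).1
      rw [e]; push_cast; exact (h1 j).2
  have hH := affineSpan_subset_hyperplane hS hsub
  rw [HasCommonWall] at h
  rw [h] at hH
  rcases eq_or_eq_negIdx_of_hyperplane_subset hH with h' | h'
  exacts [hj h', hj' h']

lemma Step.unitStep [P.IsReduced] {n n' : ι → ℤ} (hn : (cell P n).Nonempty)
    (hn' : (cell P n').Nonempty) {i : ι} (h : Step P (cell P n) (cell P n') i) :
    UnitStep P n n' i := by
  obtain ⟨-, k, hk, h1, h2⟩ := h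
  have h3 : n' i = n i + 1 := by
    have hle := (hk.cell_coord hn hn' i).1
    obtain ⟨ν, hν⟩ := hn
    obtain ⟨ν', hν'⟩ := hn'
    have e1 : n i < k := by exact_mod_cast (hν i).1.trans (h1 ν hν)
    have e2 : k < n' i + 1 := by exact_mod_cast (h2 ν' hν').trans (hν' i).2
    omega
  refine ⟨h3, ?_, fun j => (hk.cell_coord hn hn' j).2⟩
  rw [cell_negIdx hn, cell_negIdx hn', h3]
  ring

/-- Two cells whose coordinates differ by a unit step have a common wall. A segment joining inner
points of the two cells crosses that wall at a point lying on no other hyperplane, so the common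
face contains a neighbourhood of this point in the hyperplane. -/
lemma UnitStep.hasCommonWall {n n' : ι → ℤ} (hn : (cell P n).Nonempty)
    (hn' : (cell P n').Nonempty) {i : ι} (h : UnitStep P n n' i) :
    HasCommonWall P (cell P n) (cell P n') i (n' i) := by
  obtain ⟨h1, h2, h3⟩ := h
  have hneg := cell_negIdx hn i
  -- the common face, described by the coordinates away from `±α`
  have hface {q : M} (hq : P.coroot' i q = n' i) (hq' : ∀ j, j ≠ i → j ≠ negIdx P i →
      (n j : ℝ) < P.coroot' j q ∧ P.coroot' j q < n j + 1) :
      q ∈ closure (cell P n) ∩ closure (cell P n') := by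
    have h1' : (n' i : ℝ) = n i + 1 := by exact_mod_cast h1
    have hneg' : (n (negIdx P i) : ℝ) = -n i - 1 := by exact_mod_cast hneg
    have h2' : (n' (negIdx P i) : ℝ) = n (negIdx P i) - 1 := by exact_mod_cast h2
    rw [mem_inter_iff, mem_closure_cell hn, mem_closure_cell hn']
    constructor
    · intro j
      by_cases hj : j = i
      · subst hj; constructor <;> linarith
      by_cases hj' : j = negIdx P i
      · subst hj'; rw [coroot'_negIdx]; constructor <;> linarith
      exact ⟨(hq' j hj hj').1.le, (hq' j hj hj').2.le⟩
    · intro j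
      by_cases hj : j = i
      · subst hj; constructor <;> linarith
      by_cases hj' : j = negIdx P i
      · subst hj'; rw [coroot'_negIdx]; constructor <;> linarith
      rw [h3 j hj hj']
      exact ⟨(hq' j hj hj').1.le, (hq' j hj hj').2.le⟩
  obtain ⟨p, hp, hp'⟩ : ∃ p : M, P.coroot' i p = n' i ∧ ∀ j, j ≠ i → j ≠ negIdx P i →
      (n j : ℝ) < P.coroot' j p ∧ P.coroot' j p < n j + 1 := by
    obtain ⟨u, hu⟩ := hn
    obtain ⟨v, hv⟩ := hn'
    have hu1 : P.coroot' i u < n' i := by rw [h1]; push_cast; exact (hu i).2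
    have hv1 := (hv i).1
    have hd : 0 < P.coroot' i v - P.coroot' i u := by linarith
    refine ⟨((P.coroot' i v - n' i) / (P.coroot' i v - P.coroot' i u)) • u +
      ((n' i - P.coroot' i u) / (P.coroot' i v - P.coroot' i u)) • v, ?_, fun j hj hj' => ?_⟩
    · rw [map_add, map_smul, map_smul, smul_eq_mul, smul_eq_mul]
      field_simp
      ring
    · have hvj := hv j
      rw [h3 j hj hj'] at hvj
      have hc : Convex ℝ (Ioo (n j : ℝ) (n j + 1)) := convex_Ioo _ _
      rw [map_add, map_smul, map_smul]
      exact hc (hu j) hvj (div_nonneg (by linarith) hd.le) (div_nonneg (by linarith) hd.le)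
        (by rw [← add_div, div_eq_one_iff_eq hd.ne']; ring)
  have hsub : closure (cell P n) ∩ closure (cell P n') ⊆ hyperplane P i (n' i) := by
    rintro q ⟨hq1, hq2⟩
    rw [mem_closure_cell hn] at hq1
    rw [mem_closure_cell hn'] at hq2
    refine le_antisymm ?_ (hq2 i).1
    rw [h1]; push_cast; exact (hq1 i).2
  refine subset_antisymm (affineSpan_subset_hyperplane ⟨p, hface hp hp'⟩ hsub) fun q hq => ?_
  -- points of the hyperplane near `p` lie on the face; scale `q` towards `p`
  have hev : ∀ᶠ t in nhdsWithin (0 : ℝ) (Ioi 0), ∀ j, j ≠ i → j ≠ negIdx P i →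
      (n j : ℝ) < P.coroot' j (AffineMap.lineMap p q t) ∧
        P.coroot' j (AffineMap.lineMap p q t) < n j + 1 := by
    refine Filter.Eventually.filter_mono nhdsWithin_le_nhds ?_
    rw [Filter.eventually_all]
    intro j
    by_cases hj : j = i
    · simp [hj]
    by_cases hj' : j = negIdx P i
    · simp [hj']
    have hcont : Continuous fun t : ℝ => P.coroot' j (AffineMap.lineMap p q t) := by
      simp only [AffineMap.lineMap_apply_module, map_add, map_smul, smul_eq_mul]
      fun_prop
    have h0 : P.coroot' j (AffineMap.lineMap p q (0 : ℝ)) ∈ Ioo (n j : ℝ) (n j + 1) := by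
      rw [AffineMap.lineMap_apply_zero]
      exact hp' j hj hj'
    exact (hcont.continuousAt.eventually (isOpen_Ioo.mem_nhds h0)).mono fun t ht _ _ => ht
  obtain ⟨t, ht, htpos⟩ := (hev.and self_mem_nhdsWithin).exists
  have htpos : 0 < t := htpos
  have hq' : P.coroot' i q = n' i := hq
  have hmem : AffineMap.lineMap p q t ∈ closure (cell P n) ∩ closure (cell P n') := by
    refine hface ?_ ht
    rw [AffineMap.lineMap_apply_module, map_add, map_smul, map_smul, hp, hq', smul_eq_mul,
      smul_eq_mul]
    ring
  have hline : AffineMap.lineMap p (AffineMap.lineMap p q t) t⁻¹ = q := by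
    simp only [AffineMap.lineMap_apply, vsub_eq_sub, vadd_eq_add, add_sub_cancel_right, smul_smul,
      inv_mul_cancel₀ htpos.ne', one_smul, sub_add_cancel]
  rw [← hline]
  exact AffineMap.lineMap_mem _ (subset_affineSpan ℝ _ (hface hp hp'))
    (subset_affineSpan ℝ _ hmem)

lemma UnitStep.step {n n' : ι → ℤ} (hn : (cell P n).Nonempty)
    (hn' : (cell P n').Nonempty) {i : ι} (h : UnitStep P n n' i) :
    Step P (cell P n) (cell P n') i := by
  refine ⟨fun e => ?_, n' i, h.hasCommonWall hn hn', fun ν hν => ?_, fun ν hν => (hν i).1⟩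
  · have := congrFun (eq_of_cell_eq hn e) i
    rw [h.1] at this
    omega
  · rw [h.1]; push_cast; exact (hν i).2

/-! ### Paths of unit steps -/

/-- An alcove path is determined by its first alcove and its sequence of roots. -/
lemma alcovePath_unique [P.IsReduced] {m : ℕ} {γ : Fin m → ι} {A B : Fin (m + 1) → Set M}
    (hA : IsAlcovePath P A) (hB : IsAlcovePath P B) (h0 : A 0 = B 0)
    (hA' : ∀ t : Fin m, Step P (A t.castSucc) (A t.succ) (γ t))
    (hB' : ∀ t : Fin m, Step P (B t.castSucc) (B t.succ) (γ t)) : A = B := by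
  funext t
  induction t using Fin.induction with
  | zero => exact h0
  | succ t ih =>
    obtain ⟨n, hn, en⟩ := isAlcove_iff.1 (hA.1 t.castSucc)
    obtain ⟨n₁, hn₁, en₁⟩ := isAlcove_iff.1 (hA.1 t.succ)
    obtain ⟨n₂, hn₂, en₂⟩ := isAlcove_iff.1 (hB.1 t.succ)
    have hs₁ := hA' t
    have hs₂ := hB' t
    rw [← ih, en, en₂] at hs₂
    rw [en, en₁] at hs₁
    rw [en₁, en₂, (hs₁.unitStep hn hn₁).unique (hs₂.unitStep hn hn₂)]

open Classical in
/-- If `⟨λ, γ_t^∨⟩ = 1` for every root `γ_t` of an alcove path, then the path is reduced: the sum of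
the coordinates over all roots `γ` with `⟨λ, γ^∨⟩ = 1` increases by one along each of its steps,
and by at most one along any step of any alcove path. -/
lemma isReducedAlcovePath_of_coroot'_eq_one [P.IsReduced] {m : ℕ} {γ : Fin m → ι}
    {n : Fin (m + 1) → ι → ℤ} (hn : ∀ t, (cell P (n t)).Nonempty)
    (hs : ∀ t : Fin m, UnitStep P (n t.castSucc) (n t.succ) (γ t)) {lam : M}
    (hlam : ∀ t, P.coroot' (γ t) lam = 1) :
    IsReducedAlcovePath P fun t => cell P (n t) := by
  have := Fintype.ofFinite ι
  refine ⟨⟨fun t => isAlcove_iff.2 ⟨_, hn t, rfl⟩, fun t => ?_⟩, fun m' B hB hB0 hBm => ?_⟩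
  · have h := (hs t).step (hn _) (hn _)
    exact ⟨h.1, γ t, h.2.imp fun k hk => hk.1⟩
  set S : Finset ι := Finset.univ.filter fun i => P.coroot' i lam = 1 with hS
  have hmem (i : ι) : i ∈ S ↔ P.coroot' i lam = 1 := Finset.mem_filter_univ i
  have hnot {i : ι} (hi : i ∈ S) : negIdx P i ∉ S := by
    rw [hmem] at hi
    rw [hmem, coroot'_negIdx, hi]
    norm_num
  have hup (t : Fin (m + 1)) : ∑ i ∈ S, n t i = ∑ i ∈ S, n 0 i + t := by
    induction t using Fin.induction with
    | zero => simp
    | succ t ih =>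
      have hγ : γ t ∈ S := (hmem _).2 (hlam t)
      have hsub : ∑ i ∈ S, n t.succ i = ∑ i ∈ S, (n t.castSucc i + if i = γ t then 1 else 0) := by
        refine Finset.sum_congr rfl fun i hi => ?_
        split_ifs with h
        · rw [h, (hs t).1]
        · rw [(hs t).2.2 i h fun h' => hnot hγ (h' ▸ hi), add_zero]
      rw [hsub, Finset.sum_add_distrib, ih, Finset.sum_ite_eq' S (γ t), if_pos hγ]
      simp [add_assoc]
  choose nB hnB eB using fun t => isAlcove_iff.1 (hB.1 t)
  have hle (t : Fin (m' + 1)) : ∑ i ∈ S, nB t i ≤ ∑ i ∈ S, nB 0 i + t := by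
    induction t using Fin.induction with
    | zero => simp
    | succ t ih =>
      obtain ⟨-, α, k, hk⟩ := hB.2 t
      rw [eB, eB] at hk
      have hc := hk.cell_coord (hnB _) (hnB _)
      -- at most one of `α` and `-α` lies in `S`
      obtain ⟨δ, hδ⟩ : ∃ δ, ∀ i ∈ S, i ≠ δ → nB t.succ i = nB t.castSucc i := by
        by_cases hα : α ∈ S
        · exact ⟨α, fun i hi h => (hc i).2 h fun h' => hnot hα (h' ▸ hi)⟩
        · exact ⟨negIdx P α, fun i hi h => (hc i).2 (fun h' => hα (h' ▸ hi)) h⟩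
      have hsub : ∑ i ∈ S, nB t.succ i ≤
          ∑ i ∈ S, (nB t.castSucc i + if i = δ then 1 else 0) := by
        refine Finset.sum_le_sum fun i hi => ?_
        split_ifs with h
        · exact (hc i).1.1
        · rw [hδ i hi h, add_zero]
      rw [Finset.sum_add_distrib, Finset.sum_ite_eq' S δ] at hsub
      have : (if δ ∈ S then (1 : ℤ) else 0) ≤ 1 := by split_ifs <;> norm_num
      rw [Fin.val_succ]
      rw [Fin.val_castSucc] at ih
      push_cast
      linarith
  have e0 : nB 0 = n 0 := eq_of_cell_eq (hnB 0) (by rw [← eB, hB0])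
  have em : nB (Fin.last m') = n (Fin.last m) := eq_of_cell_eq (hnB _) (by rw [← eB, hBm])
  have h1 := hup (Fin.last m)
  have h2 := hle (Fin.last m')
  rw [em, e0, h1, Fin.val_last, Fin.val_last] at h2
  have : (m : ℤ) ≤ m' := by linarith
  exact_mod_cast this

end Alcoves

section WeylAlcoves

variable {ι M N : Type*} [AddCommGroup M] [Module ℝ M] [AddCommGroup N] [Module ℝ N]
  {P : RootPairing ι ℝ M N}

/-! ### The alcoves `u A_∘ + λ` -/

open Classical in
/-- The coordinates of the alcove `u A_∘`: they are `0` at the roots `α` with `u⁻¹ α > 0` and `-1`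
at the others. -/
noncomputable def weylCoord (b : P.Base) (u : P.weylGroup) (i : ι) : ℤ :=
  if b.IsPos (P.weylGroupToPerm u⁻¹ i) then 0 else -1

lemma weylCoord_of_pos {b : P.Base} {u : P.weylGroup} {i : ι}
    (h : b.IsPos (P.weylGroupToPerm u⁻¹ i)) : weylCoord b u i = 0 := if_pos h

lemma weylCoord_of_not_pos {b : P.Base} {u : P.weylGroup} {i : ι}
    (h : ¬ b.IsPos (P.weylGroupToPerm u⁻¹ i)) : weylCoord b u i = -1 := if_neg h

lemma weylCoord_congr {b : P.Base} {u v : P.weylGroup} {i : ι}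
    (h : b.IsPos (P.weylGroupToPerm u⁻¹ i) ↔ b.IsPos (P.weylGroupToPerm v⁻¹ i)) :
    weylCoord b u i = weylCoord b v i := by
  by_cases hu : b.IsPos (P.weylGroupToPerm u⁻¹ i)
  · rw [weylCoord_of_pos hu, weylCoord_of_pos (h.1 hu)]
  · rw [weylCoord_of_not_pos hu, weylCoord_of_not_pos fun hv => hu (h.2 hv)]

lemma fundamentalAlcove_eq_cell (b : P.Base) : fundamentalAlcove b = cell P (weylCoord b 1) := by
  have h1 (i : ι) : P.weylGroupToPerm 1⁻¹ i = i := by simp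
  ext ν
  constructor
  · intro h i
    by_cases hi : b.IsPos i
    · rw [weylCoord_of_pos (by rwa [h1])]
      simpa only [Int.cast_zero, zero_add] using h i hi
    · rw [weylCoord_of_not_pos (by rwa [h1])]
      have := h _ ((isPos_negIdx b i).2 hi)
      rw [coroot'_negIdx] at this
      push_cast
      constructor <;> linarith
  · intro h i hi
    have := h i
    rw [weylCoord_of_pos (by rwa [h1])] at this
    simpa only [Int.cast_zero, zero_add] using this

lemma smul_mem_cell {b : P.Base} (u : P.weylGroup) {ν : M} (hν : ν ∈ fundamentalAlcove b) :
    u • ν ∈ cell P (weylCoord b u) := by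
  intro i
  rw [coroot'_smul]
  by_cases hi : b.IsPos (P.weylGroupToPerm u⁻¹ i)
  · rw [weylCoord_of_pos hi]
    simpa only [Int.cast_zero, zero_add] using hν _ hi
  · rw [weylCoord_of_not_pos hi]
    have := hν _ ((isPos_negIdx b _).2 hi)
    rw [coroot'_negIdx] at this
    push_cast
    constructor <;> linarith

lemma image_add_cell {lam : M} {c : ι → ℤ} (hc : ∀ i, P.coroot' i lam = c i) (n : ι → ℤ) :
    (fun ν => ν + lam) '' cell P n = cell P (n + c) := by
  ext ν
  simp only [image_add_right, mem_preimage, cell, mem_ofPred_eq, map_add, map_neg, hc,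
    Pi.add_apply, Int.cast_add]
  refine forall_congr' fun i => ⟨fun h => ?_, fun h => ?_⟩ <;> constructor <;> linarith [h.1, h.2]

lemma UnitStep.symm {n n' : ι → ℤ} {i : ι} (h : UnitStep P n n' i) :
    UnitStep P n' n (negIdx P i) := by
  refine ⟨by rw [h.2.1]; ring, by rw [negIdx_negIdx, h.1]; ring, fun j h1 h2 => ?_⟩
  rw [negIdx_negIdx] at h2
  exact (h.2.2 j h2 h1).symm

lemma UnitStep.add {n n' : ι → ℤ} {i : ι} (h : UnitStep P n n' i) (c : ι → ℤ) :
    UnitStep P (n + c) (n' + c) i := by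
  refine ⟨?_, ?_, fun j h1 h2 => ?_⟩
  · simp only [Pi.add_apply, h.1]; ring
  · simp only [Pi.add_apply, h.2.1]; ring
  · simp only [Pi.add_apply, h.2.2 j h1 h2]

lemma weylCoord_apply_simple (b : P.Base) (u : P.weylGroup) (j : b.support) :
    weylCoord b u (P.weylGroupToPerm u j) = 0 :=
  weylCoord_of_pos (by
    rw [← Equiv.Perm.mul_apply, ← map_mul, inv_mul_cancel, map_one]
    exact b.isPos_of_mem_support j.2)

lemma weylCoord_mul_ofIdx_negIdx (b : P.Base) (u : P.weylGroup) (j : b.support) :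
    weylCoord b (u * RootPairing.weylGroup.ofIdx P (j : ι))
      (negIdx P (P.weylGroupToPerm u j)) = 0 := by
  have h := weylCoord_apply_simple b (u * RootPairing.weylGroup.ofIdx P (j : ι)) j
  rwa [map_mul, Equiv.Perm.mul_apply, weylGroupToPerm_ofIdx_self, weylGroupToPerm_negIdx] at h

lemma wordProd_drop_reverse (b : P.Base) {n : ℕ} (f : Fin n → b.support) (d : Fin n) :
    wordProd b ((List.ofFn f).drop d).reverse =
      wordProd b ((List.ofFn f).drop (d + 1)).reverse *
        RootPairing.weylGroup.ofIdx P (f d : ι) := by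
  have h : (List.ofFn f).drop d = f d :: (List.ofFn f).drop (d + 1) := by
    rw [List.drop_eq_getElem_cons (by simp)]
    simp
  rw [h, List.reverse_cons, wordProd_append]
  simp [wordProd]

lemma wordProd_drop_length (b : P.Base) {n : ℕ} (f : Fin n → b.support) :
    wordProd b ((List.ofFn f).drop n).reverse = 1 := by
  rw [List.drop_eq_nil_of_le (by simp), List.reverse_nil, wordProd_nil]

lemma weylCoord_drop_negIdx_wordRoot (b : P.Base) {n : ℕ} (f : Fin n → b.support) (d : Fin n) :
    weylCoord b (wordProd b ((List.ofFn f).drop d).reverse) (negIdx P (wordRoot b f d)) = 0 := by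
  rw [wordProd_drop_reverse]
  exact weylCoord_mul_ofIdx_negIdx b _ _

lemma weylCoord_drop_succ_wordRoot (b : P.Base) {n : ℕ} (f : Fin n → b.support) (d : Fin n) :
    weylCoord b (wordProd b ((List.ofFn f).drop (d + 1)).reverse) (wordRoot b f d) = 0 :=
  weylCoord_apply_simple b _ _

variable [Finite ι] [P.IsCrystallographic] [P.IsReduced]

/-- The alcoves `u A_∘` and `u s_j A_∘` are separated by the hyperplane `H_{uα_j,0}` alone. -/
lemma unitStep_weylCoord_mul (b : P.Base) (u : P.weylGroup) (j : b.support) :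
    UnitStep P (weylCoord b u) (weylCoord b (u * RootPairing.weylGroup.ofIdx P (j : ι)))
      (negIdx P (P.weylGroupToPerm u j)) := by
  have hj := b.isPos_of_mem_support j.2
  have hu : P.weylGroupToPerm u⁻¹ (P.weylGroupToPerm u j) = j := by
    rw [← Equiv.Perm.mul_apply, ← map_mul, inv_mul_cancel, map_one, Equiv.Perm.one_apply]
  have hs (i : ι) : P.weylGroupToPerm (u * RootPairing.weylGroup.ofIdx P (j : ι))⁻¹ i =
      P.reflectionPerm j (P.weylGroupToPerm u⁻¹ i) := by
    rw [mul_inv_rev, ofIdx_inv, map_mul, Equiv.Perm.mul_apply, weylGroupToPerm_ofIdx]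
  refine ⟨?_, ?_, fun i h1 h2 => weylCoord_congr ?_⟩
  · rw [weylCoord_mul_ofIdx_negIdx, weylCoord_of_not_pos]
    · norm_num
    · rw [weylGroupToPerm_negIdx, hu, isPos_negIdx, not_not]
      exact hj
  · rw [negIdx_negIdx, weylCoord_apply_simple, weylCoord_of_not_pos]
    · norm_num
    · rw [hs, hu]
      change ¬ b.IsPos (negIdx P j)
      rwa [isPos_negIdx, not_not]
  · rw [hs]
    refine isPos_reflectionPerm_iff b j.2 (fun h => h2 ?_) fun h => h1 ?_
    · rw [negIdx_negIdx]
      exact (weylGroupToPerm_inv_apply_eq u i j).1 h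
    · rw [← weylGroupToPerm_negIdx]
      exact (weylGroupToPerm_inv_apply_eq u i _).1 h

/-- Appending the letter `f d` to the word `f (n - 1), …, f (d + 1)` crosses the wall orthogonal to
`wordRoot b f d`, against the direction of that root. -/
lemma unitStep_wordRoot (b : P.Base) {n : ℕ} (f : Fin n → b.support) (d : Fin n) :
    UnitStep P (weylCoord b (wordProd b ((List.ofFn f).drop (d + 1)).reverse))
      (weylCoord b (wordProd b ((List.ofFn f).drop d).reverse)) (negIdx P (wordRoot b f d)) := by
  rw [wordProd_drop_reverse]
  exact unitStep_weylCoord_mul b _ _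

lemma fundamentalAlcove_nonempty [P.IsRootSystem] (b : P.Base) :
    (fundamentalAlcove b).Nonempty := by
  -- a small multiple of the point where all simple coroots take the value one
  obtain ⟨ρ, hρ⟩ : ∃ ρ : M, ∀ j ∈ b.support, P.coroot' j ρ = 1 := by
    refine ⟨P.toLinearMap.toPerfPair.symm (b.toCoweightBasis.constr ℝ fun _ => (1 : ℝ)),
      fun j hj => ?_⟩
    have h := b.toCoweightBasis.constr_basis ℝ (fun _ => (1 : ℝ)) ⟨j, hj⟩
    rw [b.toCoweightBasis_apply] at h
    simpa [RootPairing.coroot'] using h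
  have hpos {i : ι} (hi : b.IsPos i) : 0 < P.coroot' i ρ := by
    refine lt_of_le_of_ne
      (coroot'_nonneg_of_isPos b (fun j hj => (hρ j hj).symm ▸ zero_le_one) hi) fun h0 => ?_
    obtain ⟨f, hf⟩ := coroot_eq_sum_of_isPos b hi
    have hsum : P.coroot' i ρ = ∑ j ∈ b.support, (f j : ℝ) := by
      rw [RootPairing.coroot', hf, map_sum, LinearMap.sum_apply]
      refine Finset.sum_congr rfl fun j hj => ?_
      rw [map_nsmul, LinearMap.smul_apply]
      have := hρ j hj
      rw [RootPairing.coroot'] at this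
      rw [this, nsmul_one]
    rw [hsum] at h0
    have hz := (Finset.sum_eq_zero_iff_of_nonneg fun j _ => Nat.cast_nonneg (f j)).1 h0.symm
    refine P.flip.ne_zero i ?_
    change P.coroot i = 0
    rw [hf]
    refine Finset.sum_eq_zero fun j hj => ?_
    rw [Nat.cast_eq_zero.1 (hz j hj), zero_smul]
  obtain ⟨C, hC⟩ := (Set.finite_range fun i => P.coroot' i ρ).bddAbove
  refine ⟨(|C| + 1)⁻¹ • ρ, fun i hi => ?_⟩
  have hC0 : 0 < |C| + 1 := by positivity
  rw [map_smul, smul_eq_mul]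
  refine ⟨mul_pos (inv_pos.2 hC0) (hpos hi), ?_⟩
  rw [inv_mul_lt_iff₀ hC0, mul_one]
  have : P.coroot' i ρ ≤ C := hC ⟨i, rfl⟩
  linarith [le_abs_self C]

/-! ### Values of `λ` on the roots of the reduced words -/

lemma IsFundamentalWeight.isPos_of_coroot'_pos {b : P.Base} {k : b.support} {ϖ : M}
    (hϖ : IsFundamentalWeight b k ϖ) {i : ι} (hi : 0 < P.coroot' i ϖ) : b.IsPos i := by
  by_contra hn
  have := hϖ.coroot'_nonneg ((isPos_negIdx b i).2 hn)
  rw [coroot'_negIdx] at this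
  linarith

/-- By minimality of `x`, the reflection attached to a letter of a reduced word for `x` cannot fix
`ϖ`; otherwise that letter could be deleted. -/
lemma coroot'_wordRoot_eq_neg_one {b : P.Base} {k : b.support} {ϖ lam : M}
    (hϖ : IsFundamentalWeight b k ϖ) (hlam : IsMinuscule P lam) {x : P.weylGroup}
    (hx : IsMinLength b {w | w • ϖ = lam} x) {n : ℕ} {f : Fin n → b.support}
    (hf : IsReducedExpression b (List.ofFn f).reverse x) (c : Fin n) :
    P.coroot' (wordRoot b f c) lam = -1 := by
  set p := ((List.ofFn f).drop (c + 1)).reverse with hp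
  set q := ((List.ofFn f).take c).reverse with hq
  have hsplit : (List.ofFn f).reverse = p ++ f c :: q := by
    have h : (List.ofFn f).take c ++ f c :: (List.ofFn f).drop (c + 1) = List.ofFn f := by
      conv_rhs => rw [← List.take_append_drop c (List.ofFn f)]
      rw [List.drop_eq_getElem_cons (i := c) (by simp)]
      simp
    rw [← h, hp, hq]
    simp only [List.reverse_append, List.reverse_cons, List.append_assoc, List.singleton_append]
  rw [hsplit] at hf
  have hxw : x = wordProd b p * (RootPairing.weylGroup.ofIdx P (f c : ι) * wordProd b q) := by
    rw [← hf.1, wordProd_append, wordProd_cons]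
  have hpos := hf.isPos_right
  set ξ := P.weylGroupToPerm (wordProd b q)⁻¹ (f c) with hξ
  have hβ : P.coroot' (wordRoot b f c) lam = -P.coroot' ξ ϖ := by
    rw [← hx.1.out, coroot'_smul, ← coroot'_negIdx, hξ, wordRoot, ← Equiv.Perm.mul_apply,
      ← map_mul, ← weylGroupToPerm_negIdx, ← weylGroupToPerm_ofIdx_self, ← Equiv.Perm.mul_apply,
      ← map_mul]
    congr 4
    rw [hxw, mul_inv_rev, mul_inv_rev, ofIdx_inv, ← hp]
    group
  have hne : P.coroot' ξ ϖ ≠ 0 := by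
    intro h0
    -- `x s_ξ` is the product of the word with the letter `f c` deleted
    have e : x * RootPairing.weylGroup.ofIdx P ξ = wordProd b (p ++ q) := by
      rw [hξ, ofIdx_weylGroupToPerm, hxw, wordProd_append, inv_inv]
      have := ofIdx_mul_self (P := P) (f c : ι)
      calc _ = wordProd b p * (RootPairing.weylGroup.ofIdx P (f c : ι) *
            RootPairing.weylGroup.ofIdx P (f c : ι)) * wordProd b q := by group
        _ = _ := by rw [this, mul_one]
    have h1 := hx.2 (x * RootPairing.weylGroup.ofIdx P ξ) (by
      rw [mem_ofPred_eq, mul_smul, ofIdx_smul_apply, h0, zero_smul, sub_zero]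
      exact hx.1)
    rw [e, ← hf.2] at h1
    have h2 := h1.trans (length_wordProd_le b _)
    simp only [List.length_append, List.length_cons] at h2
    omega
  have hnonneg := hϖ.coroot'_nonneg hpos
  rcases hlam (wordRoot b f c) with h | h | h
  · exact h
  · exact absurd (by linarith) hne
  · linarith

/-- If `x` and `y x` are of minimal length among the elements with their values on the dominant
weight `ϖ`, and `y x ϖ` is antidominant, then `⟨λ, ζ⟩ = 1` for every inversion `ζ` of `y`, where
`λ = x ϖ`. -/
lemma coroot'_eq_one_of_inversion {b : P.Base} {ϖ lam μ : M}
    (hμ : ∀ i, ¬ b.IsPos i → 0 ≤ P.coroot' i μ)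
    (hlam : IsMinuscule P lam) {x y : P.weylGroup}
    (hx : IsMinLength b {w | w • ϖ = lam} x) (hy : IsMinLength b {w | w • ϖ = μ} (y * x))
    {i : ι} (hi : b.IsPos i) (hyi : ¬ b.IsPos (P.weylGroupToPerm y i)) :
    P.coroot' i lam = 1 := by
  have h1 : P.coroot' (P.weylGroupToPerm y i) μ = P.coroot' i lam := by
    rw [← hy.1.out, mul_smul, hx.1.out, coroot'_weylGroupToPerm_smul]
  have h2 := hμ _ hyi
  rw [h1] at h2
  rcases hlam i with h | h | h
  · linarith
  · exfalso
    set δ := P.weylGroupToPerm x⁻¹ i with hδ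
    have hxδ : P.weylGroupToPerm x δ = i := by
      rw [hδ, ← Equiv.Perm.mul_apply, ← map_mul, mul_inv_cancel, map_one, Equiv.Perm.one_apply]
    have h0 : P.coroot' δ ϖ = 0 := by rw [hδ, ← coroot'_smul, hx.1.out, h]
    have hp := (hx.isPos_iff h0).1 (by rwa [hxδ])
    rw [← hy.isPos_iff h0, map_mul, Equiv.Perm.mul_apply, hxδ] at hp
    exact hyi hp
  · exact h

lemma coroot'_wordRoot_eq_one {b : P.Base} {ϖ lam μ : M}
    (hμ : ∀ i, ¬ b.IsPos i → 0 ≤ P.coroot' i μ)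
    (hlam : IsMinuscule P lam) {x y : P.weylGroup}
    (hx : IsMinLength b {w | w • ϖ = lam} x) (hy : IsMinLength b {w | w • ϖ = μ} (y * x))
    {n : ℕ} {f : Fin n → b.support} (hf : IsReducedExpression b (List.ofFn f) y) (d : Fin n) :
    P.coroot' (wordRoot b f d) lam = 1 := by
  have hsplit : (List.ofFn f).take d ++ f d :: (List.ofFn f).drop (d + 1) = List.ofFn f := by
    conv_rhs => rw [← List.take_append_drop d (List.ofFn f)]
    rw [List.drop_eq_getElem_cons (i := d) (by simp)]
    simp
  rw [← hsplit] at hf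
  have hroot : wordRoot b f d =
      P.weylGroupToPerm (wordProd b ((List.ofFn f).drop (d + 1)))⁻¹ (f d) := by
    rw [wordRoot, wordProd_reverse]
  refine coroot'_eq_one_of_inversion hμ hlam hx hy ?_ ?_
  · rw [hroot]
    exact hf.isPos_right
  · have e : P.weylGroupToPerm y (wordRoot b f d) =
        negIdx P (P.weylGroupToPerm (wordProd b ((List.ofFn f).take d)) (f d)) := by
      rw [hroot, ← weylGroupToPerm_negIdx, ← weylGroupToPerm_ofIdx_self,
        ← Equiv.Perm.mul_apply, ← Equiv.Perm.mul_apply, ← map_mul, ← map_mul]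
      congr 2
      rw [← hf.1, wordProd_append, wordProd_cons]
      group
    rw [e, isPos_negIdx, not_not]
    exact hf.isPos_left

/-- The alcoves `x A_∘` and `y⁻¹ A_∘ + λ` coincide. -/
lemma weylCoord_eq_add {b : P.Base} {k : b.support} {ϖ lam μ : M}
    (hϖ : IsFundamentalWeight b k ϖ) (hμ : ∀ i, ¬ b.IsPos i → 0 ≤ P.coroot' i μ)
    (hlam : IsMinuscule P lam) {x y : P.weylGroup} (hx : x • ϖ = lam)
    (hy : IsMinLength b {w | w • ϖ = μ} (y * x)) {c : ι → ℤ}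
    (hc : ∀ i, P.coroot' i lam = c i) : weylCoord b x = weylCoord b y⁻¹ + c := by
  funext i
  have hxi : P.coroot' (P.weylGroupToPerm x⁻¹ i) ϖ = P.coroot' i lam := by
    rw [← coroot'_smul, hx]
  have hyi : P.coroot' (P.weylGroupToPerm y i) μ = P.coroot' i lam := by
    rw [← hy.1.out, mul_smul, hx, coroot'_weylGroupToPerm_smul]
  rw [Pi.add_apply]
  rcases hlam i with h | h | h
  · have hci : c i = -1 := by exact_mod_cast (hc i).symm.trans h
    rw [hci, weylCoord_of_not_pos, weylCoord_of_pos, zero_add]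
    · rw [inv_inv]
      by_contra hn
      have := hμ _ hn
      linarith
    · intro hp
      have := hϖ.coroot'_nonneg hp
      linarith
  · have hci : c i = 0 := by exact_mod_cast (hc i).symm.trans h
    rw [hci, add_zero]
    refine weylCoord_congr ?_
    rw [← hy.isPos_iff (hxi.trans h), ← Equiv.Perm.mul_apply, ← map_mul, inv_inv,
      mul_inv_cancel_right]
  · have hci : c i = 1 := by exact_mod_cast (hc i).symm.trans h
    rw [hci, weylCoord_of_pos, weylCoord_of_not_pos]
    · norm_num
    · rw [inv_inv]
      intro hp
      have := hμ (negIdx P (P.weylGroupToPerm y i)) (by rwa [isPos_negIdx, not_not])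
      rw [coroot'_negIdx] at this
      linarith
    · exact hϖ.isPos_of_coroot'_pos (by linarith)

end WeylAlcoves

end AlcoveModel

theorem lemma4p1 {ι M N : Type*} [Finite ι]
    [AddCommGroup M] [Module ℝ M] [AddCommGroup N] [Module ℝ N]
    [TopologicalSpace M] [IsTopologicalAddGroup M] [ContinuousSMul ℝ M] [T2Space M]
    (P : RootPairing ι ℝ M N) [P.IsRootSystem] [P.IsCrystallographic] [P.IsReduced]
    [P.IsIrreducible] (base : P.Base) (hlaced : base.cartanMatrix.IsSimplyLaced)
    (lam : M) (hlam : AlcoveModel.IsMinuscule P lam)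
    (k : base.support) (ϖ : M) (hϖ : AlcoveModel.IsFundamentalWeight base k ϖ)
    (w₀ : P.weylGroup) (hw₀ : AlcoveModel.IsLongest base w₀)
    (x : P.weylGroup) (hx : AlcoveModel.IsMinLength base {w | w • ϖ = lam} x)
    (y : P.weylGroup) (hy : AlcoveModel.IsMinLength base {w | w • ϖ = w₀ • ϖ} (y * x))
    (a : ℕ) (j : Fin a → base.support)
    (hj : AlcoveModel.IsReducedExpression base (List.ofFn j).reverse x)
    (b : ℕ) (i : Fin b → base.support)
    (hi : AlcoveModel.IsReducedExpression base (List.ofFn i) y) :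
    let β : Fin a → ι := AlcoveModel.wordRoot base j
    let ζ : Fin b → ι := AlcoveModel.wordRoot base i
    let Γ : Fin (a + b) → ι :=
      Fin.append (fun c : Fin a => AlcoveModel.negIdx P (β c.rev)) ζ
    ∃ A : Fin (a + b + 1) → Set M,
      AlcoveModel.IsAlcovePathOfRoots base lam Γ A ∧
      (∀ A', AlcoveModel.IsAlcovePathOfRoots base lam Γ A' → A' = A) ∧
      AlcoveModel.IsReducedAlcovePath P A ∧
      (∀ c : Fin a, AlcoveModel.HasCommonWall P
        (A (Fin.castAdd b c).castSucc) (A (Fin.castAdd b c).succ)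
        (AlcoveModel.negIdx P (β c.rev)) 0) ∧
      (∀ d : Fin b, AlcoveModel.HasCommonWall P
        (A (Fin.natAdd a d).castSucc) (A (Fin.natAdd a d).succ) (ζ d) 1) := by
  intro β ζ Γ
  have hϖ' := fun i hi => hϖ.coroot'_nonneg (i := i) hi
  have hμ := fun i hi => hw₀.coroot'_smul_nonneg hϖ' (i := i) hi
  obtain ⟨c, hc⟩ : ∃ c : ι → ℤ, ∀ i, P.coroot' i lam = c i := by
    refine Classical.axiom_of_choice (r := fun i (z : ℤ) => P.coroot' i lam = z) fun i => ?_
    rcases hlam i with h | h | h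
    exacts [⟨-1, by simpa using h⟩, ⟨0, by simpa using h⟩, ⟨1, by simpa using h⟩]
  -- coordinates of `s_{j_a} ⋯ s_{j_{t+1}} A_∘` and of `s_{i_b} ⋯ s_{i_{t+1}} A_∘ + λ`
  set U : ℕ → ι → ℤ := fun t =>
    AlcoveModel.weylCoord base (AlcoveModel.wordProd base ((List.ofFn j).drop t).reverse) with hU
  set V : ℕ → ι → ℤ := fun t =>
    AlcoveModel.weylCoord base (AlcoveModel.wordProd base ((List.ofFn i).drop t).reverse) + c
    with hV
  have hUV : U 0 = V 0 := by
    simp only [hU, hV, List.drop_zero]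
    rw [hj.1, AlcoveModel.wordProd_reverse, hi.1]
    exact AlcoveModel.weylCoord_eq_add hϖ hμ hlam hx.1 hy hc
  obtain ⟨ν, hν⟩ := AlcoveModel.fundamentalAlcove_nonempty base
  have hUne (t : ℕ) : (AlcoveModel.cell P (U t)).Nonempty := ⟨_, AlcoveModel.smul_mem_cell _ hν⟩
  have hVne (t : ℕ) : (AlcoveModel.cell P (V t)).Nonempty := by
    simp only [hV]
    rw [← AlcoveModel.image_add_cell hc]
    exact ⟨_, mem_image_of_mem _ (AlcoveModel.smul_mem_cell _ hν)⟩
  set n : Fin (a + b + 1) → ι → ℤ := fun t => if (t : ℕ) ≤ a then U (a - t) else V (t - a) with hn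
  have hnU (t : Fin (a + b + 1)) (ht : (t : ℕ) ≤ a) : n t = U (a - t) := if_pos ht
  have hnV (t : Fin (a + b + 1)) (ht : a ≤ (t : ℕ)) : n t = V (t - a) := by
    rcases ht.eq_or_lt with h | h
    · rw [hnU t h.ge, ← h, Nat.sub_self, hUV]
    · exact if_neg (not_le.2 h)
  have hne (t) : (AlcoveModel.cell P (n t)).Nonempty := by
    rcases le_total (t : ℕ) a with h | h
    · rw [hnU t h]; exact hUne _
    · rw [hnV t h]; exact hVne _
  have hleft (d : Fin a) : n (Fin.castAdd b d).castSucc = U (d.rev + 1) ∧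
      n (Fin.castAdd b d).succ = U d.rev := by
    rw [hnU _ (by simp), hnU _ (by simp), Fin.val_rev]
    constructor
    · congr 1
      have := d.2
      simp only [Fin.val_castSucc, Fin.val_castAdd]
      omega
    · simp
  have hright (d : Fin b) : n (Fin.natAdd a d).castSucc = V d ∧
      n (Fin.natAdd a d).succ = V (d + 1) := by
    rw [hnV _ (by simp), hnV _ (by simp; omega)]
    constructor
    · congr 1
      simp
    · congr 1
      simp only [Fin.val_succ, Fin.val_natAdd]
      omega
  have hsleft (d : Fin a) : AlcoveModel.UnitStep P (n (Fin.castAdd b d).castSucc)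
      (n (Fin.castAdd b d).succ) (AlcoveModel.negIdx P (β d.rev)) := by
    rw [(hleft d).1, (hleft d).2]
    exact AlcoveModel.unitStep_wordRoot base j d.rev
  have hsright (d : Fin b) : AlcoveModel.UnitStep P (n (Fin.natAdd a d).castSucc)
      (n (Fin.natAdd a d).succ) (ζ d) := by
    rw [(hright d).1, (hright d).2]
    have h := (AlcoveModel.unitStep_wordRoot base i d).symm.add c
    rwa [AlcoveModel.negIdx_negIdx] at h
  have hstep (t : Fin (a + b)) : AlcoveModel.UnitStep P (n t.castSucc) (n t.succ) (Γ t) := by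
    refine Fin.addCases (fun d => ?_) (fun d => ?_) t
    · rw [show Γ (Fin.castAdd b d) = _ from Fin.append_left _ _ d]
      exact hsleft d
    · rw [show Γ (Fin.natAdd a d) = _ from Fin.append_right _ _ d]
      exact hsright d
  have hζ (d : Fin b) : P.coroot' (ζ d) lam = 1 :=
    AlcoveModel.coroot'_wordRoot_eq_one hμ hlam hx hy hi d
  have hval (t : Fin (a + b)) : P.coroot' (Γ t) lam = 1 := by
    refine Fin.addCases (fun d => ?_) (fun d => ?_) t
    · rw [show Γ (Fin.castAdd b d) = _ from Fin.append_left _ _ d, AlcoveModel.coroot'_negIdx,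
        AlcoveModel.coroot'_wordRoot_eq_neg_one hϖ hlam hx hj, neg_neg]
    · rw [show Γ (Fin.natAdd a d) = _ from Fin.append_right _ _ d]
      exact hζ d
  have hred := AlcoveModel.isReducedAlcovePath_of_coroot'_eq_one hne hstep hval
  have hS (t : Fin (a + b)) := (hstep t).step (hne _) (hne _)
  have h0 : AlcoveModel.cell P (n 0) = AlcoveModel.fundamentalAlcove base := by
    rw [hnU 0 (by simp), AlcoveModel.fundamentalAlcove_eq_cell]
    simp only [hU, Fin.val_zero, Nat.sub_zero, AlcoveModel.wordProd_drop_length]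
  have hlast : AlcoveModel.cell P (n (Fin.last _)) =
      (fun ν => ν + lam) '' AlcoveModel.fundamentalAlcove base := by
    rw [hnV _ (by simp), AlcoveModel.fundamentalAlcove_eq_cell, AlcoveModel.image_add_cell hc]
    simp only [hV, Fin.val_last, Nat.add_sub_cancel_left, AlcoveModel.wordProd_drop_length]
  refine ⟨fun t => AlcoveModel.cell P (n t), ⟨hred.1, h0, hlast, hS⟩, fun A' hA' => ?_, hred,
    fun d => ?_, fun d => ?_⟩
  · exact AlcoveModel.alcovePath_unique hA'.1 hred.1 (hA'.2.1.trans h0.symm) hA'.2.2.2 hS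
  · have h := (hsleft d).hasCommonWall (hne _) (hne _)
    have e : n (Fin.castAdd b d).succ (AlcoveModel.negIdx P (β d.rev)) = 0 := by
      rw [(hleft d).2]
      exact AlcoveModel.weylCoord_drop_negIdx_wordRoot base j d.rev
    rwa [e] at h
  · have h := (hsright d).hasCommonWall (hne _) (hne _)
    have e : n (Fin.natAdd a d).succ (ζ d) = 1 := by
      rw [(hright d).2]
      simp only [hV, Pi.add_apply]
      rw [AlcoveModel.weylCoord_drop_succ_wordRoot, zero_add]
      exact_mod_cast (hc _).symm.trans (hζ d)
    rwa [e] at h
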